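/- Let $\mathfrak{K}$ be the collection of (equivalence classes, modulo measure-preserving isometries, of) compact metric spaces $(X,d_X,\nu_X)$ endowed with a Borel probability measure, equipped with the Gromov--Hausdorff--Prokhorov distance \[ d_{\mathrm{GHP}}\big((X,d_X,\nu_X),(Y,d_Y,\nu_Y)\big)=\inf_{E,\varphi_X,\varphi_Y}\max\big(d_{\mathrm H}(\varphi_X(X),\varphi_Y(Y)),\,d_{\mathrm P}(\nu_X\varphi_X^{-1},\nu_Y\varphi_Y^{-1})\big), \] where the infimum ranges over all isometric embeddings $\varphi_X:X\to E$, $\varphi_Y:Y\to E$ into a common metric space $E$, $d_{\mathrm H}$ is the Hausdorff distance and $d_{\mathrm P}$ the Prokhorov distance; $\mathfrak{K}$ carries the Borel $\sigma$-algebra of $d_{\mathrm{GHP}}$. For $(X,d_X,\nu_X)\in\mathfrak{K}$ and $\epsilon>0$ put \[ \rho^X_\epsilon:=\inf_{x\in X}\nu_X\big(\{y\in X: d_X(x,y)\le\epsilon\}\big), \] and say that $\nu_X$ has full support if every non-empty open subset of $X$ has positive $\nu_X$-measure. Let $(\mathsf X,d_{\mathsf X},\nu_{\mathsf X})$ and $(\mathsf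 X_n,d_{\mathsf X_n},\nu_{\mathsf X_n})$, indexed by the natural numbers $n$, be random elements of $\mathfrak{K}$ (possibly defined on different probability spaces) such that $(\mathsf X_n,d_{\mathsf X_n},\nu_{\mathsf X_n})\to(\mathsf X,d_{\mathsf X},\nu_{\mathsf X})$ in distribution with respect to $d_{\mathrm{GHP}}$. Then the following are equivalent: 1. $\nu_{\mathsf X}$ almost surely has full support. 2. For all $\epsilon,\epsilon'>0$ there are $\delta>0$ and $N\in\mathbb{N}$ such that $\mathbb{P}(\rho^{\mathsf X_n}_\epsilon<\delta)<\epsilon'$ for all $n\ge N$. -/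

import Mathlib

open MeasureTheory Metric Set Filter Topology
open scoped ENNReal

universe u

/-- A compact metric space endowed with a Borel probability measure (in particular the underlying
space is non-empty). -/
structure MeasuredCompactSpace : Type (u + 1) where
  carrier : Type u
  [metric : MetricSpace carrier]
  [compact : CompactSpace carrier]
  [measurable : MeasurableSpace carrier]
  [borel : BorelSpace carrier]
  measure : Measure carrier
  [isProb : IsProbabilityMeasure measure]

namespace MeasuredCompactSpace

instance : CoeSort MeasuredCompactSpace.{u} (Type u) := ⟨carrier⟩

attribute [instance] metric compact measurable borel isProb

instance (X : MeasuredCompactSpace.{u}) : Nonempty X :=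
  nonempty_of_isProbabilityMeasure X.measure

/-- The Gromov--Hausdorff--Prokhorov distance: the infimum, over all isometric embeddings
`φ : X → E`, `ψ : Y → E` into a common metric space `E`, of the maximum of the Hausdorff distance
of the images and the Prokhorov distance of the push-forward measures. (Only the union of the two
images matters, so it is no restriction that `E` lives in the same universe.) -/
noncomputable def ghpEDist (X Y : MeasuredCompactSpace.{u}) : ℝ≥0∞ :=
  ⨅ (E : Type u) (_ : MetricSpace E) (_ : MeasurableSpace E) (_ : BorelSpace E)
    (φ : X → E) (ψ : Y → E) (_ : Isometry φ) (_ : Isometry ψ),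
    max (hausdorffEDist (range φ) (range ψ))
      (levyProkhorovEDist (X.measure.map φ) (Y.measure.map ψ))

theorem ghpEDist_le (X Y : MeasuredCompactSpace.{u}) {E : Type u} [MetricSpace E]
    [MeasurableSpace E] [BorelSpace E] {φ : X → E} {ψ : Y → E} (hφ : Isometry φ)
    (hψ : Isometry ψ) :
    ghpEDist X Y ≤ max (hausdorffEDist (range φ) (range ψ))
      (levyProkhorovEDist (X.measure.map φ) (Y.measure.map ψ)) := by
  unfold ghpEDist
  refine iInf_le_of_le E (iInf_le_of_le ‹_› (iInf_le_of_le ‹_› (iInf_le_of_le ‹_› ?_)))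
  exact iInf_le_of_le φ (iInf_le_of_le ψ (iInf_le_of_le hφ (iInf_le_of_le hψ le_rfl)))

theorem exists_of_ghpEDist_lt {X Y : MeasuredCompactSpace.{u}} {c : ℝ≥0∞}
    (h : ghpEDist X Y < c) :
    ∃ (E : Type u) (_ : MetricSpace E) (_ : MeasurableSpace E) (_ : BorelSpace E)
      (φ : X → E) (ψ : Y → E), Isometry φ ∧ Isometry ψ ∧
      hausdorffEDist (range φ) (range ψ) < c ∧
      levyProkhorovEDist (X.measure.map φ) (Y.measure.map ψ) < c := by
  unfold ghpEDist at h
  simp only [iInf_lt_iff, max_lt_iff] at h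
  obtain ⟨E, i1, i2, i3, φ, ψ, hφ, hψ, h⟩ := h
  exact ⟨E, i1, i2, i3, φ, ψ, hφ, hψ, h⟩

theorem ghpEDist_comm_le (X Y : MeasuredCompactSpace.{u}) : ghpEDist X Y ≤ ghpEDist Y X := by
  refine le_of_forall_gt fun c hc => ?_
  obtain ⟨E, _, _, _, φ, ψ, hφ, hψ, h1, h2⟩ := exists_of_ghpEDist_lt hc
  refine (ghpEDist_le X Y hψ hφ).trans_lt (max_lt ?_ ?_)
  · rwa [hausdorffEDist_comm]
  · rwa [levyProkhorovEDist_comm]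

theorem ghpEDist_comm (X Y : MeasuredCompactSpace.{u}) : ghpEDist X Y = ghpEDist Y X :=
  le_antisymm (ghpEDist_comm_le X Y) (ghpEDist_comm_le Y X)

/-- The Prokhorov distance does not increase under isometric embeddings. -/
theorem levyProkhorovEDist_map_le {E F : Type u} [MetricSpace E] [MeasurableSpace E]
    [BorelSpace E] [MetricSpace F] [MeasurableSpace F] [BorelSpace F] {f : E → F}
    (hf : Isometry f) (μ ν : Measure E) :
    levyProkhorovEDist (μ.map f) (ν.map f) ≤ levyProkhorovEDist μ ν := by
  have hm : Measurable f := hf.continuous.measurable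
  have key : ∀ (r : ℝ) (B : Set F), thickening r (f ⁻¹' B) ⊆ f ⁻¹' thickening r B := by
    intro r B x hx
    rw [mem_thickening_iff] at hx
    obtain ⟨z, hz, hd⟩ := hx
    exact mem_thickening_iff.2 ⟨f z, hz, by rwa [hf.dist_eq]⟩
  refine levyProkhorovEDist_le_of_forall _ _ _ fun ε B hε _ hB => ?_
  rw [Measure.map_apply hm hB, Measure.map_apply hm hB,
    Measure.map_apply hm isOpen_thickening.measurableSet,
    Measure.map_apply hm isOpen_thickening.measurableSet]
  constructor
  · refine (left_measure_le_of_levyProkhorovEDist_lt hε (hm hB)).trans ?_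
    gcongr
    exact key _ _
  · refine (right_measure_le_of_levyProkhorovEDist_lt hε (hm hB)).trans ?_
    gcongr
    exact key _ _

theorem ghpEDist_triangle (X Y Z : MeasuredCompactSpace.{u}) :
    ghpEDist X Z ≤ ghpEDist X Y + ghpEDist Y Z := by
  refine ENNReal.le_of_forall_pos_le_add fun ε hε hfin => ?_
  have hε2 : (ε : ℝ≥0∞) / 2 ≠ 0 := by simp [hε.ne']
  have hXY : ghpEDist X Y < ghpEDist X Y + (ε : ℝ≥0∞) / 2 :=
    ENNReal.lt_add_right (ne_top_of_le_ne_top hfin.ne le_self_add) hε2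
  have hYZ : ghpEDist Y Z < ghpEDist Y Z + (ε : ℝ≥0∞) / 2 :=
    ENNReal.lt_add_right (ne_top_of_le_ne_top hfin.ne le_add_self) hε2
  obtain ⟨E, _, _, _, φ, ψ, hφ, hψ, h1, h2⟩ := exists_of_ghpEDist_lt hXY
  obtain ⟨F, _, _, _, φ', ψ', hφ', hψ', h1', h2'⟩ := exists_of_ghpEDist_lt hYZ
  let _ : MeasurableSpace (GlueSpace hψ hφ') := _root_.borel _
  have : BorelSpace (GlueSpace hψ hφ') := ⟨rfl⟩
  have hL := toGlueL_isometry hψ hφ'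
  have hR := toGlueR_isometry hψ hφ'
  have hcomm : toGlueL hψ hφ' ∘ ψ = toGlueR hψ hφ' ∘ φ' := toGlue_commute hψ hφ'
  have hsum : ghpEDist X Y + (ε : ℝ≥0∞) / 2 + (ghpEDist Y Z + (ε : ℝ≥0∞) / 2) =
      ghpEDist X Y + ghpEDist Y Z + ε := by
    rw [add_add_add_comm, ENNReal.add_halves]
  refine (ghpEDist_le X Z (hL.comp hφ) (hR.comp hψ')).trans ?_
  rw [← hsum]
  refine max_le ?_ ?_
  · refine (hausdorffEDist_triangle (t := range (toGlueL hψ hφ' ∘ ψ))).trans ?_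
    gcongr
    · rw [range_comp, range_comp, hausdorffEDist_image hL]
      exact h1.le
    · rw [hcomm, range_comp, range_comp, hausdorffEDist_image hR]
      exact h1'.le
  · refine (levyProkhorovEDist_triangle _ (Y.measure.map (toGlueL hψ hφ' ∘ ψ)) _).trans ?_
    gcongr
    · rw [← Measure.map_map hL.continuous.measurable hφ.continuous.measurable,
        ← Measure.map_map hL.continuous.measurable hψ.continuous.measurable]
      exact (levyProkhorovEDist_map_le hL _ _).trans h2.le
    · rw [hcomm, ← Measure.map_map hR.continuous.measurable hφ'.continuous.measurable,
        ← Measure.map_map hR.continuous.measurable hψ'.continuous.measurable]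
      exact (levyProkhorovEDist_map_le hR _ _).trans h2'.le

theorem ghpEDist_ne_top (X Y : MeasuredCompactSpace.{u}) : ghpEDist X Y ≠ ⊤ := by
  let _ : MetricSpace (X ⊕ Y) := metricSpaceSum
  let _ : MeasurableSpace (X ⊕ Y) := _root_.borel _
  have : BorelSpace (X ⊕ Y) := ⟨rfl⟩
  have hl : Isometry (Sum.inl : X → X ⊕ Y) := isometry_inl
  have hr : Isometry (Sum.inr : Y → X ⊕ Y) := isometry_inr
  have := Measure.isProbabilityMeasure_map (μ := X.measure) hl.continuous.measurable.aemeasurable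
  have := Measure.isProbabilityMeasure_map (μ := Y.measure) hr.continuous.measurable.aemeasurable
  refine ((ghpEDist_le X Y hl hr).trans_lt (max_lt ?_ ?_)).ne
  · exact (hausdorffEDist_ne_top_of_nonempty_of_bounded (range_nonempty _) (range_nonempty _)
      (isCompact_range hl.continuous).isBounded (isCompact_range hr.continuous).isBounded).lt_top
  · exact levyProkhorovEDist_lt_top _ _

/-- Two measured compact spaces are equivalent if there is a measure preserving (surjective)
isometry between them. -/
def Equivalent (X Y : MeasuredCompactSpace.{u}) : Prop :=
  ∃ e : X ≃ᵢ Y, X.measure.map e = Y.measure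

theorem equivalent_refl (X : MeasuredCompactSpace.{u}) : Equivalent X X :=
  ⟨IsometryEquiv.refl X, Measure.map_id⟩

theorem Equivalent.symm {X Y : MeasuredCompactSpace.{u}} (h : Equivalent X Y) :
    Equivalent Y X := by
  obtain ⟨e, he⟩ := h
  refine ⟨e.symm, ?_⟩
  rw [← he, Measure.map_map e.symm.continuous.measurable e.continuous.measurable,
    IsometryEquiv.symm_comp_self, Measure.map_id]

theorem Equivalent.trans {X Y Z : MeasuredCompactSpace.{u}} (h : Equivalent X Y)
    (h' : Equivalent Y Z) : Equivalent X Z := by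
  obtain ⟨e, he⟩ := h
  obtain ⟨f, hf⟩ := h'
  refine ⟨e.trans f, ?_⟩
  rw [← hf, ← he, Measure.map_map f.continuous.measurable e.continuous.measurable]
  rfl

instance setoid : Setoid MeasuredCompactSpace.{u} where
  r := Equivalent
  iseqv := ⟨equivalent_refl, Equivalent.symm, Equivalent.trans⟩

theorem ghpEDist_eq_zero_of_equivalent {X Y : MeasuredCompactSpace.{u}} (h : Equivalent X Y) :
    ghpEDist X Y = 0 := by
  obtain ⟨e, he⟩ := h
  have := ghpEDist_le X Y e.isometry isometry_id
  rw [he, Measure.map_id, levyProkhorovEDist_self, e.range_eq_univ, range_id,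
    hausdorffEDist_self, max_self] at this
  exact le_antisymm this bot_le

theorem ghpEDist_congr_le {X Y X' Y' : MeasuredCompactSpace.{u}} (hX : Equivalent X X')
    (hY : Equivalent Y Y') : ghpEDist X Y ≤ ghpEDist X' Y' := by
  refine (ghpEDist_triangle X X' Y).trans ?_
  rw [ghpEDist_eq_zero_of_equivalent hX, zero_add]
  refine (ghpEDist_triangle X' Y' Y).trans ?_
  rw [ghpEDist_eq_zero_of_equivalent hY.symm, add_zero]

/-- The minimal mass of a closed `ε`-ball. -/
noncomputable def minBallMass (ε : ℝ) (X : MeasuredCompactSpace.{u}) : ℝ :=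
  ⨅ x : X, X.measure.real (closedBall x ε)

theorem minBallMass_congr (ε : ℝ) {X Y : MeasuredCompactSpace.{u}} (h : Equivalent X Y) :
    minBallMass ε X = minBallMass ε Y := by
  obtain ⟨e, he⟩ := h
  unfold minBallMass
  refine e.toEquiv.iInf_congr fun x => ?_
  rw [← he, measureReal_def, measureReal_def,
    Measure.map_apply e.continuous.measurable measurableSet_closedBall]
  change (X.measure (e ⁻¹' closedBall (e x) ε)).toReal = _
  rw [e.isometry.preimage_closedBall]

/-- Full support: every non-empty open set has positive measure. -/
def HasFullSupport (X : MeasuredCompactSpace.{u}) : Prop :=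
  ∀ U : Set X, IsOpen U → U.Nonempty → 0 < X.measure U

theorem HasFullSupport.of_equivalent {X Y : MeasuredCompactSpace.{u}} (h : Equivalent X Y)
    (hX : HasFullSupport X) : HasFullSupport Y := by
  obtain ⟨e, he⟩ := h
  intro U hU hne
  rw [← he, Measure.map_apply e.continuous.measurable hU.measurableSet]
  exact hX _ (hU.preimage e.continuous) (hne.preimage e.surjective)

end MeasuredCompactSpace

/-- The collection `𝔎` of equivalence classes (modulo measure preserving isometries) of compact
metric spaces endowed with Borel probability measures. -/
def GHPSpace : Type (u + 1) := Quotient MeasuredCompactSpace.setoid.{u}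

namespace GHPSpace

open MeasuredCompactSpace

/-- The Gromov--Hausdorff--Prokhorov distance on `𝔎`. -/
noncomputable def distGHP : GHPSpace.{u} → GHPSpace.{u} → ℝ≥0∞ :=
  Quotient.lift₂ ghpEDist fun _ _ _ _ hX hY =>
    le_antisymm (ghpEDist_congr_le hX hY) (ghpEDist_congr_le (Equivalent.symm hX)
      (Equivalent.symm hY))

noncomputable abbrev pseudoEMetricSpace : PseudoEMetricSpace GHPSpace.{u} where
  edist := distGHP
  edist_self := by
    rintro ⟨X⟩
    exact ghpEDist_eq_zero_of_equivalent (equivalent_refl X)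
  edist_comm := by
    rintro ⟨X⟩ ⟨Y⟩
    exact ghpEDist_comm X Y
  edist_triangle := by
    rintro ⟨X⟩ ⟨Y⟩ ⟨Z⟩
    exact ghpEDist_triangle X Y Z

/-- `𝔎` with the distance `d_GHP` (which is real-valued) and its topology. -/
noncomputable instance : PseudoMetricSpace GHPSpace.{u} :=
  @PseudoEMetricSpace.toPseudoMetricSpace _ pseudoEMetricSpace (by
    rintro ⟨X⟩ ⟨Y⟩
    exact ghpEDist_ne_top X Y)

/-- The Borel `σ`-algebra of `d_GHP`. -/
noncomputable instance : MeasurableSpace GHPSpace.{u} := borel _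

instance : BorelSpace GHPSpace.{u} := ⟨rfl⟩

/-- `ρ_ε^X`: the infimum over `x ∈ X` of the mass of the closed ball of radius `ε` around `x`. -/
noncomputable def rho (ε : ℝ) : GHPSpace.{u} → ℝ :=
  Quotient.lift (minBallMass ε) fun _ _ h => minBallMass_congr ε h

/-- The measure of (any representative of) a class in `𝔎` has full support. -/
def FullSupport : GHPSpace.{u} → Prop :=
  Quotient.lift HasFullSupport fun _ _ h =>
    propext ⟨HasFullSupport.of_equivalent h, HasFullSupport.of_equivalent (Equivalent.symm h)⟩

end GHPSpace

namespace MeasuredCompactSpace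

/-! By compactness, full support means that `rho ε` is positive for every `ε > 0`. The function `rho
ε` need not be continuous, but it is stable up to a change of radius: moving by less than `η` in the
GHP distance costs `2 * η` in the radius and `η` in the mass (`minBallMass_le_of_ghpEDist_lt`).
Hence the closure of `{rho ε < δ}` lies in `{rho (ε / 2) ≤ 2 * δ}`, and its interior contains `{rho
(2 * ε) = 0}`. The portmanteau theorem, applied to the closure for one implication and to the
interior for the other, does the rest; measurability of `rho` is never needed. -/

theorem minBallMass_le (ε : ℝ) (X : MeasuredCompactSpace.{u}) (x : X) :
    minBallMass ε X ≤ X.measure.real (closedBall x ε) :=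
  ciInf_le ⟨0, by rintro _ ⟨y, rfl⟩; exact measureReal_nonneg⟩ x

theorem minBallMass_nonneg (ε : ℝ) (X : MeasuredCompactSpace.{u}) : 0 ≤ minBallMass ε X :=
  le_ciInf fun _ => measureReal_nonneg

theorem minBallMass_mono (X : MeasuredCompactSpace.{u}) : Monotone fun ε => minBallMass ε X := by
  intro ε ε' h
  exact le_ciInf fun x => (minBallMass_le ε X x).trans
    (measureReal_mono (closedBall_subset_closedBall h))

/-- The minimal ball masses of two spaces at small Gromov--Hausdorff--Prokhorov distance are
comparable. -/
theorem minBallMass_le_of_ghpEDist_lt {X Y : MeasuredCompactSpace.{u}} {η : ℝ} (hη : 0 < η)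
    (h : ghpEDist X Y < ENNReal.ofReal η) (ε : ℝ) :
    minBallMass ε X ≤ minBallMass (ε + 2 * η) Y + η := by
  obtain ⟨E, _, _, _, φ, ψ, hφ, hψ, hH, hP⟩ := exists_of_ghpEDist_lt h
  rw [← sub_le_iff_le_add]
  refine le_ciInf fun y => ?_
  rw [sub_le_iff_le_add]
  rw [hausdorffEDist_comm] at hH
  obtain ⟨_, ⟨x, rfl⟩, hx⟩ := exists_edist_lt_of_hausdorffEDist_lt (mem_range_self y) hH
  rw [edist_dist, ENNReal.ofReal_lt_ofReal_iff hη] at hx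
  refine (minBallMass_le ε X x).trans ?_
  have h1 := left_measure_le_of_levyProkhorovEDist_lt hP
    (measurableSet_closedBall (x := φ x) (ε := ε))
  rw [Measure.map_apply hφ.continuous.measurable measurableSet_closedBall,
    Measure.map_apply hψ.continuous.measurable isOpen_thickening.measurableSet,
    hφ.preimage_closedBall, ENNReal.toReal_ofReal hη.le] at h1
  -- One `η` pays for the thickening in the Prokhorov distance, the other for the Hausdorff distance
  -- from `ψ y` to `φ x`.
  have hsub : ψ ⁻¹' thickening η (closedBall (φ x) ε) ⊆ closedBall y (ε + 2 * η) := by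
    intro z hz
    obtain ⟨w, hw, hzw⟩ := mem_thickening_iff.1 hz
    rw [mem_closedBall] at hw ⊢
    rw [← hψ.dist_eq]
    have := dist_triangle4 (ψ z) w (φ x) (ψ y)
    rw [dist_comm (φ x)] at this
    linarith
  have h2 := h1.trans (add_le_add_left (measure_mono hsub) _)
  have h3 := ENNReal.toReal_mono (by finiteness) h2
  rwa [ENNReal.toReal_add (by finiteness) (by finiteness), ENNReal.toReal_ofReal hη.le] at h3

/-- By compactness, full support means that the minimal mass of balls of any given radius is
positive. -/
theorem hasFullSupport_iff_minBallMass_pos (X : MeasuredCompactSpace.{u}) :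
    HasFullSupport X ↔ ∀ ε : ℝ, 0 < ε → 0 < minBallMass ε X := by
  constructor
  · intro h ε hε
    -- With radius `ε / 2`, every closed `ε`-ball contains one of finitely many open balls, so the
    -- least of their masses is a lower bound.
    obtain ⟨t, -, ht, hcov⟩ := finite_cover_balls_of_compact (isCompact_univ (X := X)) (half_pos hε)
    have hne : t.Nonempty := by
      obtain ⟨x⟩ : Nonempty X := inferInstance
      obtain ⟨y, hy, -⟩ := mem_iUnion₂.1 (hcov (mem_univ x))
      exact ⟨y, hy⟩
    obtain ⟨y₀, -, hy₀⟩ := Set.exists_min_image t (fun y => X.measure.real (ball y (ε / 2))) ht hne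
    refine lt_of_lt_of_le (ENNReal.toReal_pos (h (ball y₀ (ε / 2)) isOpen_ball
      (nonempty_ball.2 (half_pos hε))).ne' (by finiteness)) (le_ciInf fun x => ?_)
    obtain ⟨y, hy, hxy⟩ := mem_iUnion₂.1 (hcov (mem_univ x))
    refine (hy₀ y hy).trans (measureReal_mono (ball_subset_closedBall.trans
      (closedBall_subset_closedBall' ?_)))
    rw [mem_ball, dist_comm] at hxy
    linarith
  · intro h U hU ⟨x, hx⟩
    obtain ⟨ε, hε, hball⟩ := nhds_basis_closedBall.mem_iff.1 (hU.mem_nhds hx)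
    have := (h ε hε).trans_le (minBallMass_le ε X x)
    exact (ENNReal.toReal_pos_iff.1 this).1.trans_le (measure_mono hball)

end MeasuredCompactSpace

/-! ### Stability of `rho` on classes, and its consequences for laws -/

namespace GHPSpace

open MeasuredCompactSpace

theorem rho_nonneg (ε : ℝ) (Z : GHPSpace.{u}) : 0 ≤ rho ε Z := by
  obtain ⟨X⟩ := Z
  exact minBallMass_nonneg ε X

theorem rho_mono (Z : GHPSpace.{u}) : Monotone fun ε => rho ε Z := by
  obtain ⟨X⟩ := Z
  exact minBallMass_mono X

theorem fullSupport_iff_rho_pos (Z : GHPSpace.{u}) :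
    Z.FullSupport ↔ ∀ ε : ℝ, 0 < ε → 0 < rho ε Z := by
  obtain ⟨X⟩ := Z
  exact hasFullSupport_iff_minBallMass_pos X

theorem rho_le_of_dist_lt {Z W : GHPSpace.{u}} {η : ℝ} (h : dist Z W < η) (ε : ℝ) :
    rho ε Z ≤ rho (ε + 2 * η) W + η := by
  have hη : 0 < η := dist_nonneg.trans_lt h
  rw [← ENNReal.ofReal_lt_ofReal_iff hη, ← edist_dist] at h
  obtain ⟨X⟩ := Z
  obtain ⟨Y⟩ := W
  exact minBallMass_le_of_ghpEDist_lt hη h ε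

/-- An approximant at distance below `min δ (ε / 4)` enlarges the radius from `ε / 2` to at most `ε`
and adds at most `δ` to the mass. -/
theorem rho_le_of_mem_closure {ε δ : ℝ} (hε : 0 < ε) (hδ : 0 < δ) {Z : GHPSpace.{u}}
    (hZ : Z ∈ closure {W | rho ε W < δ}) : rho (ε / 2) Z ≤ 2 * δ := by
  obtain ⟨W, hW, hd⟩ := Metric.mem_closure_iff.1 hZ (min δ (ε / 4)) (by positivity)
  have h1 := rho_le_of_dist_lt hd (ε / 2)
  have h2 : rho (ε / 2 + 2 * min δ (ε / 4)) W ≤ rho ε W :=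
    rho_mono W (by linarith [min_le_right δ (ε / 4)])
  have h3 : rho ε W < δ := hW
  linarith [min_le_left δ (ε / 4)]

/-- On a ball of radius `min (δ / 2) (ε / 2)` around `Z`, comparison with radius at most `2 * ε`
leaves only the mass error, at most `δ / 2`. -/
theorem mem_interior_of_rho_eq_zero {ε δ : ℝ} (hε : 0 < ε) (hδ : 0 < δ) {Z : GHPSpace.{u}}
    (hZ : rho (2 * ε) Z = 0) : Z ∈ interior {W | rho ε W < δ} := by
  rw [mem_interior_iff_mem_nhds, Metric.mem_nhds_iff]
  refine ⟨min (δ / 2) (ε / 2), by positivity, fun W hW => ?_⟩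
  have h1 := rho_le_of_dist_lt (mem_ball.1 hW) ε
  have h2 : rho (ε + 2 * min (δ / 2) (ε / 2)) Z ≤ rho (2 * ε) Z :=
    rho_mono Z (by linarith [min_le_right (δ / 2) (ε / 2)])
  change rho ε W < δ
  linarith [min_le_left (δ / 2) (ε / 2)]

/-- If a law charges only spaces of full support, then it gives small mass to the closure of the
set of spaces whose minimal ball mass is below a small threshold. -/
theorem exists_measure_closure_rho_lt {μ : Measure GHPSpace.{u}} [IsFiniteMeasure μ]
    (h : ∀ᵐ Z ∂μ, Z.FullSupport) {ε : ℝ} (hε : 0 < ε) {c : ℝ≥0∞} (hc : 0 < c) :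
    ∃ δ : ℝ, 0 < δ ∧ μ (closure {Z | rho ε Z < δ}) < c := by
  have hanti : Antitone fun k : ℕ => closure {Z : GHPSpace.{u} | rho ε Z < 1 / ((k : ℝ) + 1)} :=
    fun k l hkl => closure_mono fun Z hZ => by
      rw [mem_ofPred_eq] at hZ ⊢
      exact hZ.trans_le (Nat.one_div_le_one_div hkl)
  have hlim := tendsto_measure_iInter_atTop (μ := μ)
    (fun k => isClosed_closure.measurableSet.nullMeasurableSet) hanti ⟨0, measure_ne_top _ _⟩
  -- A point of every closure has `rho (ε / 2)` at most `2 / (k + 1)` for all `k`, hence zero, which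
  -- excludes full support.
  have hzero : μ (⋂ k : ℕ, closure {Z : GHPSpace.{u} | rho ε Z < 1 / ((k : ℝ) + 1)}) = 0 := by
    refine measure_mono_null (fun Z hZ => ?_) (ae_iff.1 h)
    rw [mem_ofPred_eq]
    intro hfull
    have hpos := (fullSupport_iff_rho_pos Z).1 hfull (ε / 2) (half_pos hε)
    obtain ⟨k, hk⟩ := exists_nat_one_div_lt (half_pos hpos)
    have := rho_le_of_mem_closure hε Nat.one_div_pos_of_nat (mem_iInter.1 hZ k)
    linarith
  rw [hzero] at hlim
  obtain ⟨k, hk⟩ := (hlim.eventually_lt_const hc).exists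
  exact ⟨_, Nat.one_div_pos_of_nat, hk⟩

/-- Spaces with `rho (2 * ε) = 0` lie in all these interiors, so they form a null set; by
monotonicity in the radius, countably many radii suffice. -/
theorem ae_fullSupport_of_forall {μ : Measure GHPSpace.{u}}
    (h : ∀ ε : ℝ, 0 < ε → ∀ c : ℝ≥0∞, 0 < c → ∃ δ : ℝ, 0 < δ ∧
      μ (interior {Z | rho ε Z < δ}) ≤ c) : ∀ᵐ Z ∂μ, Z.FullSupport := by
  have key : ∀ k : ℕ, ∀ᵐ Z ∂μ, rho (2 * (1 / ((k : ℝ) + 1))) Z ≠ 0 := by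
    intro k
    refine ae_iff.2 (le_antisymm (le_of_forall_gt_imp_ge_of_dense fun c hc => ?_) bot_le)
    obtain ⟨δ, hδ, hle⟩ := h (1 / ((k : ℝ) + 1)) Nat.one_div_pos_of_nat c hc
    refine (measure_mono fun Z hZ => ?_).trans hle
    exact mem_interior_of_rho_eq_zero Nat.one_div_pos_of_nat hδ (not_not.1 hZ)
  filter_upwards [ae_all_iff.2 key] with Z hZ
  refine (fullSupport_iff_rho_pos Z).2 fun ε hε => ?_
  obtain ⟨k, hk⟩ := exists_nat_one_div_lt (half_pos hε)
  exact ((rho_nonneg _ Z).lt_of_ne' (hZ k)).trans_le (rho_mono Z (by linarith))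

/-- Replacing sublevel sets of `rho` by their interiors changes nothing after the union over radii,
and makes the complement visibly Borel. This lets the almost sure statement pass to the law of the
limit. -/
theorem measurableSet_fullSupport : MeasurableSet {Z : GHPSpace.{u} | Z.FullSupport} := by
  have h : {Z : GHPSpace.{u} | Z.FullSupport}ᶜ = ⋃ k : ℕ, ⋂ j : ℕ,
      interior {Z : GHPSpace.{u} | rho (1 / ((k : ℝ) + 1)) Z < 1 / ((j : ℝ) + 1)} := by
    ext Z
    simp only [mem_compl_iff, mem_ofPred_eq, fullSupport_iff_rho_pos, mem_iUnion, mem_iInter]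
    constructor
    · intro h
      push Not at h
      obtain ⟨ε, hε, hZ⟩ := h
      obtain ⟨k, hk⟩ := exists_nat_one_div_lt (half_pos hε)
      refine ⟨k, fun j => mem_interior_of_rho_eq_zero Nat.one_div_pos_of_nat
        Nat.one_div_pos_of_nat (le_antisymm (le_trans (rho_mono Z ?_) hZ) (rho_nonneg _ Z))⟩
      linarith
    · rintro ⟨k, hk⟩ h
      obtain ⟨j, hj⟩ := exists_nat_one_div_lt (h _ (Nat.one_div_pos_of_nat (n := k)))
      have hlt := interior_subset (hk j)
      rw [mem_ofPred_eq] at hlt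
      exact lt_asymm hj hlt
  rw [← compl_compl {Z : GHPSpace.{u} | Z.FullSupport}, h]
  exact (MeasurableSet.iUnion fun k => MeasurableSet.iInter fun j =>
    isOpen_interior.measurableSet).compl

end GHPSpace

open GHPSpace

theorem mainTheorem2 {Ω : ℕ → Type*} {Ω' : Type*} [∀ n, MeasurableSpace (Ω n)]
    [MeasurableSpace Ω'] (P : ∀ n, Measure (Ω n)) [∀ n, IsProbabilityMeasure (P n)]
    (P' : Measure Ω') [IsProbabilityMeasure P']
    (X : ∀ n, Ω n → GHPSpace.{u}) (X' : Ω' → GHPSpace.{u})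
    (h : TendstoInDistribution X atTop X' P P') :
    (∀ᵐ ω ∂P', (X' ω).FullSupport) ↔
      ∀ ε : ℝ, 0 < ε → ∀ ε' : ℝ, 0 < ε' → ∃ δ : ℝ, 0 < δ ∧ ∃ N : ℕ, ∀ n : ℕ, N ≤ n →
        (P n).real {ω | (X n ω).rho ε < δ} < ε' := by
  have hX := h.forall_aemeasurable
  have hX' := h.aemeasurable_limit
  have := Measure.isProbabilityMeasure_map hX'
  rw [← ae_map_iff hX' measurableSet_fullSupport]
  constructor
  · intro hfull ε hε ε' hε'
    obtain ⟨δ, hδ, hlt⟩ := exists_measure_closure_rho_lt hfull hε (ENNReal.ofReal_pos.2 hε')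
    have hlim := (ProbabilityMeasure.limsup_measure_closed_le_of_tendsto h.tendsto
      (isClosed_closure (s := {Z : GHPSpace.{u} | rho ε Z < δ}))).trans_lt hlt
    obtain ⟨N, hN⟩ := eventually_atTop.1 (eventually_lt_of_limsup_lt hlim)
    refine ⟨δ, hδ, N, fun n hn => ?_⟩
    have hn' : (P n).map (X n) (closure {Z | rho ε Z < δ}) < ENNReal.ofReal ε' := hN n hn
    rw [Measure.map_apply_of_aemeasurable (hX n) isClosed_closure.measurableSet] at hn'
    -- The event itself may fail to be measurable; monotonicity of outer measure suffices.
    exact (ENNReal.lt_ofReal_iff_toReal_lt (measure_ne_top _ _)).1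
      ((measure_mono (preimage_mono (f := X n) subset_closure)).trans_lt hn')
  · refine fun hρ => ae_fullSupport_of_forall fun ε hε c hc => ?_
    -- The bound `c` may be infinite, so a finite positive `r < c` serves as `ε'`.
    obtain ⟨r, hr, hrc⟩ := ENNReal.lt_iff_exists_nnreal_btwn.1 hc
    obtain ⟨δ, hδ, N, hN⟩ := hρ ε hε r (by exact_mod_cast hr)
    refine ⟨δ, hδ, (ProbabilityMeasure.le_liminf_measure_open_of_tendsto h.tendsto
      (isOpen_interior (s := {Z : GHPSpace.{u} | rho ε Z < δ}))).trans ?_⟩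
    refine liminf_le_of_frequently_le' (Eventually.frequently ?_)
    filter_upwards [eventually_ge_atTop N] with n hn
    change (P n).map (X n) (interior {Z | rho ε Z < δ}) ≤ c
    rw [Measure.map_apply_of_aemeasurable (hX n) isOpen_interior.measurableSet]
    have hn' := (ENNReal.lt_ofReal_iff_toReal_lt (measure_ne_top _ _)).2 (hN n hn)
    rw [ENNReal.ofReal_coe_nnreal] at hn'
    exact (measure_mono (preimage_mono (f := X n) interior_subset)).trans (hn'.trans hrc).le
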